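/- Let $n\ge 0$ and let $H=\sum_{j=1}^{n-1}H_{j,j+1}$ be a nearest-neighbor Hamiltonian on a chain of $n$ qubits labelled $1,\dots,n$: each $H_{j,j+1}$ is Hermitian, acts only on qubits $j,j+1$ (as the identity on the others), and has spectral norm $\|H_{j,j+1}\|\le 1$. Let $A=\sum_{j\text{ odd}}H_{j,j+1}$ and $B=\sum_{j\text{ even}}H_{j,j+1}$, so $H=A+B$. For a real $t\ge 0$ and an integer $r\ge 1$ put $U_0(t)=e^{-iHt}$ and $U(t)=\left(e^{-iAt/r}e^{-iBt/r}\right)^r$. Let $\mathcal E$ be a (discrete or continuous) 1-design ensemble of $n$-qubit pure states, that is, a probability measure on unit vectors whose average density matrix $\mathbb E_{\psi\sim\mathcal E}|\psi\rangle\langle\psi|$ equals that of the Haar ensemble, and let $R(U(t),U_0(t))=\mathbb E_{\psi\sim\mathcal E}\,\|U(t)|\psi\rangle-U_0(t)|\psi\rangle\|_2$ be the average $\ell_2$ error. (1) For every constant $c<1$ there is a constant $C>0$, depending only on $c$, such that for all $n,r,t$, all such Hamiltonians and all such ensembles, $$\frac{\|[A,B]\|\,t^2}{2r}\le c\quad\Longrightarrow\quad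 R(U(t),U_0(t))\le C\,\sqrt n\left(\frac tr+\frac{t^3}{r^2}\right).$$ (2) There are absolute constants $c>0$ and $C>0$ such that for all $n,r,t$, all such Hamiltonians and all such ensembles, $$\frac{n t^2}{r}\le c\quad\Longrightarrow\quad R(U(t),U_0(t))\le C\,\sqrt n\left(\frac tr+\frac{t^3}{r^2}\right).$$ -/

import Mathlib

open MeasureTheory
open scoped Matrix.Norms.L2Operator

noncomputable section

/-- The `n`-qubit Hilbert space `(ℂ²)^{⊗ n} = ℂ^(2^n)`, with its Euclidean (`ℓ²`) norm; the
computational basis is indexed by bit strings. -/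
abbrev QState (n : ℕ) : Type := EuclideanSpace ℂ (Fin n → Fin 2)

/-- Operators on `n` qubits, as matrices in the computational basis. Norms of operators are
spectral norms (largest singular value), by the opened scope of instances. -/
abbrev QOp (n : ℕ) : Type := Matrix (Fin n → Fin 2) (Fin n → Fin 2) ℂ

/-- `M` acts only on the qubits in `S`: it is `N ⊗ 𝟙`, where `N` is an operator on the qubits in
`S` and `𝟙` is the identity on the other qubits. -/
def ActsOn {n : ℕ} (S : Finset (Fin n)) (M : QOp n) : Prop :=
  ∃ N : Matrix (S → Fin 2) (S → Fin 2) ℂ, ∀ x y : Fin n → Fin 2,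
    M x y = if ∀ i, i ∉ S → x i = y i then N (fun i => x i) (fun i => y i) else 0

/-- The qubits `j` and `j + 1` of a chain of `n` qubits labelled `1, …, n` (the element `i` of
`Fin n` is the qubit with label `i + 1`). -/
def qubitPair (n j : ℕ) : Finset (Fin n) :=
  {i : Fin n | (i : ℕ) + 1 = j ∨ (i : ℕ) + 1 = j + 1}

/-- The terms `h j`, `1 ≤ j ≤ n - 1`, are those of a one-dimensional nearest-neighbor Hamiltonian:
`h j` is Hermitian, acts on the qubits `j, j + 1`, and has spectral norm at most `1`. -/
structure IsNearestNeighbor {n : ℕ} (h : ℕ → QOp n) : Prop where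
  isHermitian : ∀ j ∈ Finset.Ico 1 n, (h j).IsHermitian
  actsOn : ∀ j ∈ Finset.Ico 1 n, ActsOn (qubitPair n j) (h j)
  norm_le_one : ∀ j ∈ Finset.Ico 1 n, ‖h j‖ ≤ 1

/-- The Hamiltonian `H = ∑_{j=1}^{n-1} h_j`. -/
def hamiltonian {n : ℕ} (h : ℕ → QOp n) : QOp n :=
  ∑ j ∈ Finset.Ico 1 n, h j

/-- `A`, the sum of the terms with odd `j`. -/
def oddPart {n : ℕ} (h : ℕ → QOp n) : QOp n :=
  ∑ j ∈ Finset.Ico 1 n with Odd j, h j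

/-- `B`, the sum of the terms with even `j`. -/
def evenPart {n : ℕ} (h : ℕ → QOp n) : QOp n :=
  ∑ j ∈ Finset.Ico 1 n with Even j, h j

/-- The evolution `e^{-iHs}` for time `s` generated by `H`. -/
def evolution {n : ℕ} (H : QOp n) (s : ℝ) : QOp n :=
  NormedSpace.exp ((-(Complex.I * (s : ℂ))) • H)

/-- The first-order product formula `(e^{-iAt/r} e^{-iBt/r})^r` with `r` steps. -/
def trotter {n : ℕ} (A B : QOp n) (t : ℝ) (r : ℕ) : QOp n :=
  (evolution A (t / r) * evolution B (t / r)) ^ r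

/-- Unit vectors of the `n`-qubit Hilbert space. -/
abbrev PureState (n : ℕ) : Type := Metric.sphere (0 : QState n) 1

/-- The Haar measure on pure states: the surface measure of the unit sphere, normalized to total
mass one. -/
def haarState (n : ℕ) : Measure (PureState n) :=
  ((volume : Measure (QState n)).toSphere Set.univ)⁻¹ • (volume : Measure (QState n)).toSphere

/-- The average density matrix `𝔼 |ψ⟩⟨ψ|` of an ensemble of pure states. -/
def averageState {n : ℕ} (μ : Measure (PureState n)) : QOp n :=
  Matrix.of fun x y => ∫ ψ, (ψ : QState n) x * star ((ψ : QState n) y) ∂μ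

/-- A (discrete or continuous) ensemble of pure states is a `1`-design if its average density
matrix is that of the Haar ensemble. -/
structure IsOneDesign {n : ℕ} (μ : Measure (PureState n)) : Prop where
  isProbabilityMeasure : IsProbabilityMeasure μ
  averageState_eq : averageState μ = averageState (haarState n)

/-- The average `ℓ²` error `𝔼 ‖U|ψ⟩ - U₀|ψ⟩‖₂` over the ensemble `μ`. -/
def averageError {n : ℕ} (μ : Measure (PureState n)) (U U₀ : QOp n) : ℝ :=
  ∫ ψ, ‖Matrix.toEuclideanCLM (𝕜 := ℂ) U (ψ : QState n) -
    Matrix.toEuclideanCLM (𝕜 := ℂ) U₀ (ψ : QState n)‖ ∂μ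

end

/-! Averaging a squared norm over a 1-design only sees the average state, which is maximally mixed.
Hence, by Cauchy–Schwarz, the average error is at most ‖U - U₀‖_HS / √d with d = 2^n
(`IsOneDesign.averageError_sq_le`). It remains to bound the Hilbert–Schmidt distance by a constant
times √(nd) (t/r + t³/r²).

With s = t/r, p = -iA/2 and b = -iB, the step e^{2sp} e^{sb} is conjugate by e^{sp} to the Strang
step e^{sp} e^{sb} e^{sp}, whose local error is s³ times nested commutators of p and b. The r local
errors add up to the term t³/r². Undoing the conjugation costs only a boundary term, at most 2s
times the norm of p minus any scalar, which gives t/r (`hsNorm_splitting_sub_exp_le`).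

The factor √n comes from locality: the nested commutators and the traceless part of A are sums of
O(n) local operators of Hilbert–Schmidt norm O(√d), and distant ones are orthogonal, so squared
norms add up to a constant factor (`hsNorm_lie_lie_sum_sq_le`,
`IsNearestNeighbor.exists_hsNorm_sum_sub_sq_le`). -/

section HilbertSchmidt

/-! ### The Hilbert–Schmidt norm -/

section Basic

variable {ι : Type*} [Fintype ι]

/-- A matrix as a vector of the Euclidean space of its entries. -/
def hsVec : Matrix ι ι ℂ →ₗ[ℂ] EuclideanSpace ℂ (ι × ι) where
  toFun M := WithLp.toLp 2 fun p => M p.1 p.2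
  map_add' _ _ := rfl
  map_smul' _ _ := rfl

/-- The Hilbert–Schmidt (Frobenius) norm. -/
noncomputable def hsNorm (M : Matrix ι ι ℂ) : ℝ := ‖hsVec M‖

lemma hsNorm_nonneg (M : Matrix ι ι ℂ) : 0 ≤ hsNorm M := norm_nonneg _

lemma hsNorm_add_le (M N : Matrix ι ι ℂ) : hsNorm (M + N) ≤ hsNorm M + hsNorm N := by
  simp only [hsNorm, map_add]; exact norm_add_le _ _

lemma hsNorm_sub_le (M N : Matrix ι ι ℂ) : hsNorm (M - N) ≤ hsNorm M + hsNorm N := by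
  simp only [hsNorm, map_sub]; exact norm_sub_le _ _

lemma hsNorm_smul (c : ℂ) (M : Matrix ι ι ℂ) : hsNorm (c • M) = ‖c‖ * hsNorm M := by
  simp only [hsNorm, map_smul, norm_smul]

lemma hsNorm_sq (M : Matrix ι ι ℂ) : hsNorm M ^ 2 = ∑ x, ∑ y, ‖M x y‖ ^ 2 := by
  rw [hsNorm, EuclideanSpace.norm_sq_eq, Fintype.sum_prod_type]; rfl

lemma inner_hsVec (M N : Matrix ι ι ℂ) :
    inner ℂ (hsVec M) (hsVec N) = (M.conjTranspose * N).trace := by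
  rw [PiLp.inner_apply, Fintype.sum_prod_type, Finset.sum_comm]
  simp only [Matrix.trace, Matrix.diag_apply, Matrix.mul_apply]
  exact Finset.sum_congr rfl fun _ _ => Finset.sum_congr rfl fun _ _ => mul_comm _ _

lemma hsNorm_conjTranspose (M : Matrix ι ι ℂ) : hsNorm M.conjTranspose = hsNorm M := by
  rw [← sq_eq_sq₀ (hsNorm_nonneg _) (hsNorm_nonneg _), hsNorm_sq, hsNorm_sq, Finset.sum_comm]
  simp

end Basic

variable {ι : Type*} [Fintype ι] [DecidableEq ι]

/-- Column by column: each column of `M * N` is `M` applied to a column of `N`. -/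
lemma hsNorm_mul_le (M N : Matrix ι ι ℂ) : hsNorm (M * N) ≤ ‖M‖ * hsNorm N := by
  rw [← sq_le_sq₀ (hsNorm_nonneg _) (mul_nonneg (norm_nonneg _) (hsNorm_nonneg _)), mul_pow,
    hsNorm_sq, hsNorm_sq, Finset.sum_comm, Finset.sum_comm (f := fun x y => ‖N x y‖ ^ 2),
    Finset.mul_sum]
  refine Finset.sum_le_sum fun y _ => ?_
  have h := Matrix.l2_opNorm_mulVec M (WithLp.toLp 2 fun x => N x y)
  have h2 := pow_le_pow_left₀ (norm_nonneg _) h 2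
  rw [mul_pow, EuclideanSpace.norm_sq_eq, EuclideanSpace.norm_sq_eq] at h2
  exact h2

lemma hsNorm_mul_le' (M N : Matrix ι ι ℂ) : hsNorm (M * N) ≤ hsNorm M * ‖N‖ := by
  rw [← hsNorm_conjTranspose, Matrix.conjTranspose_mul, ← hsNorm_conjTranspose M,
    ← Matrix.l2_opNorm_conjTranspose N, mul_comm (hsNorm _)]
  exact hsNorm_mul_le _ _

lemma hsNorm_one_sq : hsNorm (1 : Matrix ι ι ℂ) ^ 2 = Fintype.card ι := by
  rw [hsNorm_sq]
  simp [Matrix.one_apply, apply_ite (fun z : ℂ => ‖z‖ ^ 2)]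

lemma hsNorm_mul_le_of_norm_le_one {M : Matrix ι ι ℂ} (hM : ‖M‖ ≤ 1) (N : Matrix ι ι ℂ) :
    hsNorm (M * N) ≤ hsNorm N :=
  (hsNorm_mul_le M N).trans (mul_le_of_le_one_left (hsNorm_nonneg _) hM)

lemma hsNorm_mul_le_of_norm_le_one' (M : Matrix ι ι ℂ) {N : Matrix ι ι ℂ} (hN : ‖N‖ ≤ 1) :
    hsNorm (M * N) ≤ hsNorm M :=
  (hsNorm_mul_le' M N).trans (mul_le_of_le_one_right (hsNorm_nonneg _) hN)

/-- Mean value inequality for the Hilbert–Schmidt norm. -/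
lemma hsNorm_sub_le_of_hasDerivAt {f f' : ℝ → Matrix ι ι ℂ} {C s : ℝ} (hs : 0 ≤ s)
    (hf : ∀ x, HasDerivAt f (f' x) x) (hC : ∀ x ∈ Set.Icc 0 s, hsNorm (f' x) ≤ C) :
    hsNorm (f s - f 0) ≤ C * s := by
  -- Derivatives are taken in the spectral norm; in finite dimension `hsVec` is continuous and
  -- carries them to the Euclidean space.
  let φ : Matrix ι ι ℂ →L[ℝ] EuclideanSpace ℂ (ι × ι) :=
    LinearMap.toContinuousLinearMap (hsVec.restrictScalars ℝ)
  have h := norm_image_sub_le_of_norm_deriv_le_segment' (f := fun x => φ (f x))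
    (f' := fun x => φ (f' x)) (a := 0) (b := s) (C := C)
    (fun x _ => (φ.hasFDerivAt.comp_hasDerivAt x (hf x)).hasDerivWithinAt)
    (fun x hx => hC x (Set.Ico_subset_Icc_self hx)) s (Set.right_mem_Icc.2 hs)
  rw [← map_sub, sub_zero] at h
  exact h

lemma hsNorm_pow_sub_pow_le {M N : Matrix ι ι ℂ} (hM : ‖M‖ ≤ 1) (hN : ‖N‖ ≤ 1) (r : ℕ) :
    hsNorm (M ^ r - N ^ r) ≤ r * hsNorm (M - N) := by
  induction r with
  | zero => simp [hsNorm]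
  | succ k ih =>
    have e : M ^ (k + 1) - N ^ (k + 1) = M * (M ^ k - N ^ k) + (M - N) * N ^ k := by
      rw [pow_succ', pow_succ']; noncomm_ring
    have hNk : ‖N ^ k‖ ≤ 1 := by
      cases isEmpty_or_nonempty ι
      · simp [Subsingleton.elim (N ^ k) 0]
      · exact (norm_pow_le _ _).trans (pow_le_one₀ (norm_nonneg _) hN)
    rw [e]
    refine (hsNorm_add_le _ _).trans ?_
    have h1 := (hsNorm_mul_le_of_norm_le_one hM (M ^ k - N ^ k)).trans ih
    have h2 := hsNorm_mul_le_of_norm_le_one' (M - N) hNk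
    push_cast
    linarith

end HilbertSchmidt

/-! ### Unitary one-parameter groups and splitting errors -/

section Exponential

variable {ι : Type*} [Fintype ι] [DecidableEq ι]

lemma norm_le_one_of_mem_unitary {U : Matrix ι ι ℂ} (hU : U ∈ unitary (Matrix ι ι ℂ)) :
    ‖U‖ ≤ 1 := by
  cases isEmpty_or_nonempty ι
  · simp [Subsingleton.elim U 0]
  · exact (CStarRing.norm_of_mem_unitary hU).le

lemma exp_smul_mem_unitary {a : Matrix ι ι ℂ} (ha : a ∈ skewAdjoint (Matrix ι ι ℂ)) (s : ℝ) :
    NormedSpace.exp (s • a) ∈ unitary (Matrix ι ι ℂ) := by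
  let +nondep : NormedAlgebra ℚ (Matrix ι ι ℂ) := .restrictScalars ℚ ℂ _
  exact NormedSpace.exp_mem_unitary_of_mem_skewAdjoint (skewAdjoint.smul_mem s ha)

lemma norm_exp_smul_le_one {a : Matrix ι ι ℂ} (ha : a ∈ skewAdjoint (Matrix ι ι ℂ)) (s : ℝ) :
    ‖NormedSpace.exp (s • a)‖ ≤ 1 :=
  norm_le_one_of_mem_unitary (exp_smul_mem_unitary ha s)

lemma exp_smul_mul_exp_smul_neg (a : Matrix ι ι ℂ) (s : ℝ) :
    NormedSpace.exp (s • a) * NormedSpace.exp (s • -a) = 1 := by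
  rw [← Matrix.exp_add_of_commute]
  · simp
  · exact ((Commute.refl a).neg_right.smul_left s).smul_right s

lemma exp_smul_neg_mul_exp_smul (a : Matrix ι ι ℂ) (s : ℝ) :
    NormedSpace.exp (s • -a) * NormedSpace.exp (s • a) = 1 := by
  simpa using exp_smul_mul_exp_smul_neg (-a) s

lemma hasDerivAt_exp_conj (a X : Matrix ι ι ℂ) (s : ℝ) :
    HasDerivAt (fun s : ℝ => NormedSpace.exp (s • a) * X * NormedSpace.exp (s • -a))
      (NormedSpace.exp (s • a) * ⁅a, X⁆ * NormedSpace.exp (s • -a)) s := by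
  -- The two forms of the derivative put `a` and `-a` next to `X`, so that the commutator appears in
  -- the middle.
  have h1 := hasDerivAt_exp_smul_const (𝕂 := ℝ) a s
  have h2 := hasDerivAt_exp_smul_const' (𝕂 := ℝ) (-a) s
  refine ((h1.mul_const X).mul h2).congr_deriv ?_
  rw [Ring.lie_def]
  noncomm_ring

/-- First-order estimate of a conjugation by a unitary one-parameter group. -/
lemma hsNorm_exp_conj_sub_le {a : Matrix ι ι ℂ} (ha : a ∈ skewAdjoint (Matrix ι ι ℂ))
    (X : Matrix ι ι ℂ) {s : ℝ} (hs : 0 ≤ s) :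
    hsNorm (NormedSpace.exp (s • a) * X * NormedSpace.exp (s • -a) - X) ≤ hsNorm ⁅a, X⁆ * s := by
  have h := hsNorm_sub_le_of_hasDerivAt hs (hasDerivAt_exp_conj a X)
    (C := hsNorm ⁅a, X⁆) fun x _ =>
      (hsNorm_mul_le_of_norm_le_one' _ (norm_exp_smul_le_one (neg_mem ha) x)).trans
        (hsNorm_mul_le_of_norm_le_one (norm_exp_smul_le_one ha x) _)
  simpa using h

/-- Second-order estimate of a conjugation by a unitary one-parameter group. -/
lemma hsNorm_exp_conj_sub_sub_le {a : Matrix ι ι ℂ} (ha : a ∈ skewAdjoint (Matrix ι ι ℂ))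
    (X : Matrix ι ι ℂ) {s : ℝ} (hs : 0 ≤ s) :
    hsNorm (NormedSpace.exp (s • a) * X * NormedSpace.exp (s • -a) - X - s • ⁅a, X⁆) ≤
      hsNorm ⁅a, ⁅a, X⁆⁆ * s ^ 2 := by
  have hd (x : ℝ) : HasDerivAt
      (fun s : ℝ => NormedSpace.exp (s • a) * X * NormedSpace.exp (s • -a) - s • ⁅a, X⁆)
      (NormedSpace.exp (x • a) * ⁅a, X⁆ * NormedSpace.exp (x • -a) - ⁅a, X⁆) x := by
    have h := (hasDerivAt_exp_conj a X x).sub ((hasDerivAt_id x).smul_const ⁅a, X⁆)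
    rw [one_smul] at h
    exact h
  -- The derivative is the first-order remainder for `⁅a, X⁆`. Bounding it uniformly on `[0, s]`
  -- gives `s ^ 2` instead of `s ^ 2 / 2`.
  have h := hsNorm_sub_le_of_hasDerivAt hs hd (C := hsNorm ⁅a, ⁅a, X⁆⁆ * s) fun x hx =>
    (hsNorm_exp_conj_sub_le ha ⁅a, X⁆ hx.1).trans
      (mul_le_mul_of_nonneg_left hx.2 (hsNorm_nonneg _))
  rw [sq, ← mul_assoc]
  convert h using 2
  simp
  abel

/-- Local error of the symmetric (Strang) splitting. -/
lemma hsNorm_strang_sub_exp_le {p b : Matrix ι ι ℂ} (hp : p ∈ skewAdjoint (Matrix ι ι ℂ))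
    (hb : b ∈ skewAdjoint (Matrix ι ι ℂ)) {s : ℝ} (hs : 0 ≤ s) :
    hsNorm (NormedSpace.exp (s • p) * NormedSpace.exp (s • b) * NormedSpace.exp (s • p) -
      NormedSpace.exp (s • (p + p + b))) ≤
      (hsNorm ⁅b, ⁅b, p⁆⁆ + hsNorm ⁅p, ⁅p, b⁆⁆) * s ^ 3 := by
  set g := p + p + b with hg
  have hgs : g ∈ skewAdjoint (Matrix ι ι ℂ) := add_mem (add_mem hp hp) hb
  -- Since `⁅-b, p⁆ = ⁅p, b⁆`, the first-order terms of the two conjugations cancel. The derivative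
  -- is thus a difference of second-order remainders, up to unitary factors.
  have hd (x : ℝ) : HasDerivAt (fun s : ℝ => NormedSpace.exp (s • p) * NormedSpace.exp (s • b) *
        NormedSpace.exp (s • p) * NormedSpace.exp (s • -g))
      (NormedSpace.exp (x • p) * (NormedSpace.exp (x • b) *
        ((NormedSpace.exp (x • -b) * p * NormedSpace.exp (x • - -b) - p - x • ⁅-b, p⁆) -
          (NormedSpace.exp (x • p) * b * NormedSpace.exp (x • -p) - b - x • ⁅p, b⁆))) *
          NormedSpace.exp (x • p) * NormedSpace.exp (x • -g)) x := by
    have h1 := hasDerivAt_exp_smul_const (𝕂 := ℝ) p x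
    have h2 := hasDerivAt_exp_smul_const (𝕂 := ℝ) b x
    have h3 := hasDerivAt_exp_smul_const' (𝕂 := ℝ) (-g) x
    refine (((h1.mul h2).mul h1).mul h3).congr_deriv ?_
    symm
    have e1 := exp_smul_mul_exp_smul_neg b x
    have e2 := exp_smul_neg_mul_exp_smul p x
    have e3 := (((Commute.refl p).smul_left x).exp_left).eq
    rw [neg_neg]
    simp only [Ring.lie_def, Pi.mul_apply]
    generalize NormedSpace.exp (x • p) = P at *
    generalize NormedSpace.exp (x • b) = Q at *
    generalize NormedSpace.exp (x • -b) = Q' at *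
    generalize NormedSpace.exp (x • -p) = P' at *
    generalize NormedSpace.exp (x • -g) = V at *
    have s1 : x • (-b * p - p * -b) = x • (p * b - b * p) := by congr 1; noncomm_ring
    rw [s1]
    have : Q' * p * Q - p - x • (p * b - b * p) - (P * b * P' - b - x • (p * b - b * p)) =
      Q' * p * Q - p - P * b * P' + b := by abel
    rw [this]
    calc P * (Q * (Q' * p * Q - p - P * b * P' + b)) * P * V
        = P * (Q * Q') * p * Q * P * V - P * Q * (p * P) * V - P * Q * P * b * (P' * P) * V +
          P * Q * b * P * V := by noncomm_ring
      _ = _ := by rw [e1, e2, ← e3, hg]; noncomm_ring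
  have h := hsNorm_sub_le_of_hasDerivAt hs hd
    (C := (hsNorm ⁅b, ⁅b, p⁆⁆ + hsNorm ⁅p, ⁅p, b⁆⁆) * s ^ 2) fun x hx => by
      refine (hsNorm_mul_le_of_norm_le_one' _ (norm_exp_smul_le_one (neg_mem hgs) x)).trans ?_
      refine (hsNorm_mul_le_of_norm_le_one' _ (norm_exp_smul_le_one hp x)).trans ?_
      refine (hsNorm_mul_le_of_norm_le_one (norm_exp_smul_le_one hp x) _).trans ?_
      refine (hsNorm_mul_le_of_norm_le_one (norm_exp_smul_le_one hb x) _).trans ?_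
      refine (hsNorm_sub_le _ _).trans ?_
      have k1 := hsNorm_exp_conj_sub_sub_le (neg_mem hb) p hx.1
      have k2 := hsNorm_exp_conj_sub_sub_le hp b hx.1
      have k3 : ⁅-b, ⁅-b, p⁆⁆ = ⁅b, ⁅b, p⁆⁆ := by
        simp only [Ring.lie_def]; noncomm_ring
      rw [k3] at k1
      refine (add_le_add k1 k2).trans ?_
      rw [← add_mul]
      have := hsNorm_nonneg ⁅b, ⁅b, p⁆⁆
      have := hsNorm_nonneg ⁅p, ⁅p, b⁆⁆
      have := hx.1
      have := hx.2
      gcongr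
  have e := exp_smul_neg_mul_exp_smul g s
  -- Multiplying by the unitary `exp (s • g)` turns the distance to 1 into the distance between the
  -- two evolutions.
  have h' := (hsNorm_mul_le_of_norm_le_one' (NormedSpace.exp (s • p) * NormedSpace.exp (s • b) *
    NormedSpace.exp (s • p) * NormedSpace.exp (s • -g) - 1) (norm_exp_smul_le_one hgs s))
  rw [sub_mul, mul_assoc _ (NormedSpace.exp (s • -g)), e, mul_one, one_mul] at h'
  refine h'.trans ?_
  rw [pow_succ, ← mul_assoc]
  simpa using h

/-- Global error of the first-order splitting, with the local errors of the symmetric one and a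
boundary term. -/
lemma hsNorm_splitting_sub_exp_le {p b : Matrix ι ι ℂ} (hp : p ∈ skewAdjoint (Matrix ι ι ℂ))
    (hb : b ∈ skewAdjoint (Matrix ι ι ℂ)) {s : ℝ} (hs : 0 ≤ s) (r : ℕ) {c : ℂ} :
    hsNorm ((NormedSpace.exp (s • (p + p)) * NormedSpace.exp (s • b)) ^ r -
      NormedSpace.exp (s • (p + p + b)) ^ r) ≤
      r * ((hsNorm ⁅b, ⁅b, p⁆⁆ + hsNorm ⁅p, ⁅p, b⁆⁆) * s ^ 3) +
        2 * hsNorm (p - c • (1 : Matrix ι ι ℂ)) * s := by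
  have hg : p + p + b ∈ skewAdjoint (Matrix ι ι ℂ) := add_mem (add_mem hp hp) hb
  set V := NormedSpace.exp (s • (p + p + b)) ^ r
  set S := NormedSpace.exp (s • p) * NormedSpace.exp (s • b) * NormedSpace.exp (s • p) with hS
  have hP := norm_exp_smul_le_one hp s
  have hP' := norm_exp_smul_le_one (neg_mem hp) s
  have hSn : ‖S‖ ≤ 1 := by
    refine (norm_mul_le _ _).trans (mul_le_one₀ ((norm_mul_le _ _).trans
      (mul_le_one₀ hP (norm_nonneg _) (norm_exp_smul_le_one hb s))) (norm_nonneg _) hP)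
  have hVn : ‖V‖ ≤ 1 := norm_le_one_of_mem_unitary
    (pow_mem (exp_smul_mem_unitary hg s) r)
  have e1 := exp_smul_mul_exp_smul_neg p s
  have e2 := exp_smul_neg_mul_exp_smul p s
  have hadd : NormedSpace.exp (s • (p + p)) =
      NormedSpace.exp (s • p) * NormedSpace.exp (s • p) := by
    rw [smul_add, Matrix.exp_add_of_commute _ _ (Commute.refl _)]
  have hconj : (NormedSpace.exp (s • (p + p)) * NormedSpace.exp (s • b)) ^ r =
      NormedSpace.exp (s • p) * S ^ r * NormedSpace.exp (s • -p) := by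
    have h1 : SemiconjBy (NormedSpace.exp (s • p)) S
        (NormedSpace.exp (s • (p + p)) * NormedSpace.exp (s • b)) := by
      rw [SemiconjBy, hadd, hS]
      simp only [mul_assoc]
    have h2 := (h1.pow_right r).eq
    rw [h2, mul_assoc, e1, mul_one]
  have e : NormedSpace.exp (s • p) * S ^ r * NormedSpace.exp (s • -p) - V =
      NormedSpace.exp (s • p) * (S ^ r - V) * NormedSpace.exp (s • -p) +
        (NormedSpace.exp (s • p) * V * NormedSpace.exp (s • -p) - V) := by noncomm_ring
  rw [hconj, e]
  refine (hsNorm_add_le _ _).trans (add_le_add ?_ ?_)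
  · refine (hsNorm_mul_le_of_norm_le_one' _ hP').trans ?_
    refine (hsNorm_mul_le_of_norm_le_one hP _).trans ?_
    refine (hsNorm_pow_sub_pow_le hSn (norm_exp_smul_le_one hg s) r).trans ?_
    exact mul_le_mul_of_nonneg_left (hsNorm_strang_sub_exp_le hp hb hs) (Nat.cast_nonneg _)
  · refine (hsNorm_exp_conj_sub_le hp V hs).trans (mul_le_mul_of_nonneg_right ?_ hs)
    -- Scalars commute with `V`, so `c` is free; it will be chosen to remove the trace of `p`.
    have e3 : ⁅p, V⁆ = (p - c • (1 : Matrix ι ι ℂ)) * V - V * (p - c • (1 : Matrix ι ι ℂ)) := by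
      rw [Ring.lie_def, sub_mul, mul_sub]
      simp
    rw [e3, two_mul]
    exact (hsNorm_sub_le _ _).trans (add_le_add (hsNorm_mul_le_of_norm_le_one' _ hVn)
      (hsNorm_mul_le_of_norm_le_one hVn _))

end Exponential

/-! ### Operators with disjoint supports -/

section Locality

variable {n : ℕ} {S T : Finset (Fin n)} {M N : QOp n}

/-- Operators with disjoint supports commute. -/
lemma ActsOn.commute (hM : ActsOn S M) (hN : ActsOn T N) (hST : Disjoint S T) : Commute M N := by
  obtain ⟨M', hM⟩ := hM
  obtain ⟨N', hN⟩ := hN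
  have key {S T : Finset (Fin n)} (hST : Disjoint S T) (M' : Matrix (S → Fin 2) (S → Fin 2) ℂ)
      (N' : Matrix (T → Fin 2) (T → Fin 2) ℂ) {M N : QOp n}
      (hM : ∀ x y : Fin n → Fin 2,
        M x y = if ∀ i, i ∉ S → x i = y i then M' (fun i => x i) (fun i => y i) else 0)
      (hN : ∀ x y : Fin n → Fin 2,
        N x y = if ∀ i, i ∉ T → x i = y i then N' (fun i => x i) (fun i => y i) else 0)
      (x z : Fin n → Fin 2) : (M * N) x z = if ∀ i, i ∉ S → i ∉ T → x i = z i then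
        M' (fun i => x i) (fun i => z i) * N' (fun i => x i) (fun i => z i) else 0 := by
    -- Only one intermediate bit string contributes: it must agree with `z` on `S` and with `x`
    -- elsewhere. The resulting formula is symmetric in the two operators.
    rw [Matrix.mul_apply, Finset.sum_eq_single (fun i => if i ∈ S then z i else x i)]
    · rw [hM, hN, if_pos (fun i hi => by simp [hi])]
      have e1 : (fun i : S => if (i : Fin n) ∈ S then z i else x i) = fun i : S => z i := by
        ext i; simp
      have e2 : (fun i : T => if (i : Fin n) ∈ S then z i else x i) = fun i : T => x i := by
        ext i; simp [Finset.disjoint_right.1 hST i.2]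
      rw [e1, e2, mul_ite, mul_zero]
      congr 1
      refine propext (forall_congr' fun i => ?_)
      by_cases hi : i ∈ S <;> simp [hi]
    · intro y _ hy
      rw [hM, hN]
      split_ifs with h1 h2
      · refine absurd (funext fun i => ?_) hy
        by_cases hi : i ∈ S
        · simp [hi, h2 i (Finset.disjoint_left.1 hST hi)]
        · simp [hi, h1 i hi]
      all_goals simp
    · simp
  ext x z
  rw [key hST M' N' hM hN, key hST.symm N' M' hN hM, mul_comm]
  congr 1
  exact propext (forall_congr' fun i => imp.swap)

/-- The trace is multiplicative on operators with disjoint supports. -/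
lemma ActsOn.trace_mul (hM : ActsOn S M) (hN : ActsOn T N) (hST : Disjoint S T) :
    (Fintype.card (Fin n → Fin 2) : ℂ) * (M * N).trace = M.trace * N.trace := by
  obtain ⟨M', hM⟩ := hM
  obtain ⟨N', hN⟩ := hN
  have htr : (M * N).trace = ∑ x, M x x * N x x := by
    rw [Matrix.trace]
    refine Finset.sum_congr rfl fun x _ => ?_
    rw [Matrix.diag_apply, Matrix.mul_apply, Finset.sum_eq_single x (fun y _ hy => ?_) (by simp)]
    rw [hM, hN]
    split_ifs with h1 h2
    · refine absurd (funext fun i => ?_) hy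
      by_cases hi : i ∈ S
      · exact h2 i (Finset.disjoint_left.1 hST hi)
      · exact (h1 i hi).symm
    all_goals simp
  -- Exchanging the bits in `T` between two independent bit strings decouples the argument of `N`
  -- from that of `M`.
  let f : (Fin n → Fin 2) × (Fin n → Fin 2) → (Fin n → Fin 2) × (Fin n → Fin 2) := fun p =>
    (fun i => if i ∈ T then p.2 i else p.1 i, fun i => if i ∈ T then p.1 i else p.2 i)
  have hf : Function.Involutive f := fun p => by
    ext i <;> by_cases hi : i ∈ T <;> simp [f, hi]
  have h1 : M.trace * N.trace = ∑ p : (Fin n → Fin 2) × (Fin n → Fin 2), M p.1 p.1 * N p.2 p.2 := by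
    rw [Matrix.trace, Matrix.trace, Finset.sum_mul_sum, Fintype.sum_prod_type]
    rfl
  have h2 : (Fintype.card (Fin n → Fin 2) : ℂ) * (M * N).trace =
      ∑ p : (Fin n → Fin 2) × (Fin n → Fin 2), M p.1 p.1 * N p.1 p.1 := by
    rw [htr, Fintype.sum_prod_type, Finset.mul_sum]
    simp
  rw [h1, h2]
  refine Fintype.sum_equiv (hf.toPerm f) _ _ fun p => ?_
  have e1 : (fun i : S => (f p).1 i) = fun i : S => p.1 i := by
    ext i; simp [f, Finset.disjoint_left.1 hST i.2]
  have e2 : (fun i : T => (f p).2 i) = fun i : T => p.1 i := by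
    ext i; simp [f]
  simp only [Function.Involutive.coe_toPerm, hM, hN, e1, e2, implies_true, if_true]

lemma disjoint_qubitPair {n i j : ℕ} (hij : i + 2 ≤ j ∨ j + 2 ≤ i) :
    Disjoint (qubitPair n i) (qubitPair n j) := by
  rw [Finset.disjoint_left]
  intro k hk hk'
  simp only [qubitPair, Finset.mem_filter, Finset.mem_univ, true_and] at hk hk'
  omega

end Locality

/-! ### Sums of almost orthogonal operators -/

section AlmostOrthogonal

variable {ι : Type*} [Fintype ι]

lemma card_filter_near_le (s : Finset ℕ) (i w : ℕ) :
    (s.filter fun j => j ≤ i + w ∧ i ≤ j + w).card ≤ 2 * w + 1 := by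
  have : (s.filter fun j => j ≤ i + w ∧ i ≤ j + w) ⊆ Finset.Icc (i - w) (i + w) := by
    intro j hj
    rw [Finset.mem_filter] at hj
    rw [Finset.mem_Icc]
    omega
  refine (Finset.card_le_card this).trans ?_
  rw [Nat.card_Icc]
  omega

/-- A sum of operators that are orthogonal as soon as their indices are more than `w` apart. -/
lemma hsNorm_sum_sq_le {s : Finset ℕ} {X : ℕ → Matrix ι ι ℂ} {K : ℝ} {w : ℕ}
    (hK : ∀ i ∈ s, hsNorm (X i) ≤ K)
    (hX : ∀ i ∈ s, ∀ j ∈ s, ¬ (j ≤ i + w ∧ i ≤ j + w) → ((X i).conjTranspose * X j).trace = 0) :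
    hsNorm (∑ i ∈ s, X i) ^ 2 ≤ s.card * ((2 * w + 1 : ℕ) * K ^ 2) := by
  have h : hsNorm (∑ i ∈ s, X i) ^ 2 =
      ∑ i ∈ s, ∑ j ∈ s, (((X i).conjTranspose * X j).trace).re := by
    rw [hsNorm, @norm_sq_eq_re_inner ℂ, inner_hsVec, Matrix.conjTranspose_sum, Finset.sum_mul_sum,
      Matrix.trace_sum]
    simp [Matrix.trace_sum]
  rw [h, ← nsmul_eq_mul]
  refine Finset.sum_le_card_nsmul _ _ _ fun i hi => ?_
  -- Each row of the Gram matrix has at most `2 * w + 1` nonzero entries, each at most `K ^ 2` by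
  -- Cauchy–Schwarz.
  rw [← Finset.sum_filter_of_ne (p := fun j => j ≤ i + w ∧ i ≤ j + w) fun j hj hne => by
    by_contra hc
    exact hne (by rw [hX i hi j hj hc, Complex.zero_re])]
  have hK0 : 0 ≤ K := (hsNorm_nonneg _).trans (hK i hi)
  refine (Finset.sum_le_card_nsmul _ _ (K ^ 2) fun j hj => ?_).trans ?_
  · rw [← inner_hsVec, sq]
    exact (Complex.re_le_norm _).trans ((norm_inner_le_norm _ _).trans
      (mul_le_mul (hK i hi) (hK j (Finset.mem_filter.1 hj).1) (norm_nonneg _) hK0))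
  · rw [nsmul_eq_mul]
    exact mul_le_mul_of_nonneg_right (by exact_mod_cast card_filter_near_le s i w) (sq_nonneg K)

end AlmostOrthogonal

/-! ### Nested commutators of local terms -/

section Commutators

variable {ι : Type*} [Fintype ι]

lemma lie_sum_right (x : Matrix ι ι ℂ) (s : Finset ℕ) (f : ℕ → Matrix ι ι ℂ) :
    ⁅x, ∑ i ∈ s, f i⁆ = ∑ i ∈ s, ⁅x, f i⁆ := by
  simp only [Ring.lie_def, Finset.mul_sum, Finset.sum_mul, Finset.sum_sub_distrib]

lemma Commute.lie_bracket_right {x y z : Matrix ι ι ℂ} (hy : Commute x y) (hz : Commute x z) :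
    Commute x ⁅y, z⁆ := by
  rw [Ring.lie_def]
  exact (hy.mul_right hz).sub_right (hz.mul_right hy)

/-- By cyclicity of the trace. This is the source of orthogonality: it suffices that `z` commutes
with the outer factor of the commutator. -/
lemma trace_mul_lie_eq_zero {z x : Matrix ι ι ℂ} (h : Commute z x) (y : Matrix ι ι ℂ) :
    (z * ⁅x, y⁆).trace = 0 := by
  rw [Ring.lie_def, mul_sub, Matrix.trace_sub, ← mul_assoc, ← mul_assoc, Matrix.trace_mul_cycle z y x,
    h.eq, sub_self]

variable [DecidableEq ι]

lemma norm_lie_le (x y : Matrix ι ι ℂ) : ‖⁅x, y⁆‖ ≤ 2 * (‖x‖ * ‖y‖) := by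
  rw [Ring.lie_def, two_mul]
  refine (norm_sub_le _ _).trans (add_le_add (norm_mul_le _ _) ?_)
  rw [mul_comm ‖x‖]
  exact norm_mul_le _ _

/-- Locality: terms commuting with `y` drop out, which cuts a global sum down to a window of bounded
size. -/
lemma lie_sum_eq_lie_sum_filter {s : Finset ℕ} {h : ℕ → Matrix ι ι ℂ} {y : Matrix ι ι ℂ}
    (p : ℕ → Prop) [DecidablePred p] (hy : ∀ j ∈ s, ¬ p j → Commute (h j) y) :
    ⁅∑ j ∈ s, h j, y⁆ = ⁅∑ j ∈ s with p j, h j, y⁆ := by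
  rw [← Finset.sum_filter_add_sum_filter_not s p]
  have : Commute (∑ j ∈ s with ¬ p j, h j) y :=
    Commute.sum_left _ _ _ fun j hj => hy j (Finset.mem_filter.1 hj).1 (Finset.mem_filter.1 hj).2
  simp only [Ring.lie_def, add_mul, mul_add, this.eq]
  abel

/-- Nested commutators of sums of local terms have Hilbert–Schmidt norm of order the square root
of the number of terms. -/
lemma hsNorm_lie_lie_sum_sq_le {U s s' : Finset ℕ} (hs : s ⊆ U) (hs' : s' ⊆ U)
    {h : ℕ → Matrix ι ι ℂ} (hh : ∀ j ∈ U, (h j).IsHermitian) (hn : ∀ j ∈ U, ‖h j‖ ≤ 1)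
    (hc : ∀ i ∈ U, ∀ j ∈ U, (i + 2 ≤ j ∨ j + 2 ≤ i) → Commute (h i) (h j)) :
    hsNorm ⁅∑ j ∈ s, h j, ⁅∑ j ∈ s, h j, ∑ i ∈ s', h i⁆⁆ ^ 2 ≤
      46800 * (s'.card * Fintype.card ι) := by
  set P := ∑ j ∈ s, h j
  set Q : ℕ → ℕ → Matrix ι ι ℂ := fun i k => ∑ j ∈ s with (j ≤ i + k ∧ i ≤ j + k), h j
  have hQn (i k : ℕ) : ‖Q i k‖ ≤ (2 * k + 1 : ℕ) := by
    refine (norm_sum_le _ _).trans ((Finset.sum_le_card_nsmul _ _ 1 fun j hj =>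
      hn j (hs (Finset.mem_filter.1 hj).1)).trans ?_)
    rw [nsmul_one]
    exact_mod_cast card_filter_near_le s i k
  have hsum : ⁅P, ⁅P, ∑ i ∈ s', h i⁆⁆ = ∑ i ∈ s', ⁅P, ⁅P, h i⁆⁆ := by
    rw [lie_sum_right, lie_sum_right]
  have hQc {z : Matrix ι ι ℂ} {i k : ℕ}
      (hz : ∀ l ∈ U, l ≤ i + k → i ≤ l + k → Commute z (h l)) : Commute z (Q i k) :=
    Commute.sum_right _ _ _ fun j hj => by
      rw [Finset.mem_filter] at hj
      exact hz j (hs hj.1) hj.2.1 hj.2.2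
  have h1 : ∀ i ∈ s', ⁅P, h i⁆ = ⁅Q i 1, h i⁆ := fun i hi =>
    lie_sum_eq_lie_sum_filter _ fun j hj hij => hc j (hs hj) i (hs' hi) (by omega)
  have h2 : ∀ i ∈ s', ⁅P, ⁅P, h i⁆⁆ = ⁅Q i 2, ⁅Q i 1, h i⁆⁆ := fun i hi => by
    rw [h1 i hi]
    exact lie_sum_eq_lie_sum_filter _ fun j hj hij =>
      Commute.lie_bracket_right (hQc fun l hl _ _ => hc j (hs hj) l hl (by omega))
        (hc j (hs hj) i (hs' hi) (by omega))
  have h3 : ∀ i ∈ s', ∀ k ∈ U, ¬ (k ≤ i + 3 ∧ i ≤ k + 3) → Commute (h k) ⁅P, ⁅P, h i⁆⁆ := by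
    intro i hi k hk hik
    rw [h2 i hi]
    exact Commute.lie_bracket_right (hQc fun l hl _ _ => hc k hk l hl (by omega))
      (Commute.lie_bracket_right (hQc fun l hl _ _ => hc k hk l hl (by omega))
        (hc k hk i (hs' hi) (by omega)))
  have hK : ∀ i ∈ s', hsNorm ⁅P, ⁅P, h i⁆⁆ ≤ 60 * hsNorm (1 : Matrix ι ι ℂ) := by
    intro i hi
    have hb : ‖⁅P, ⁅P, h i⁆⁆‖ ≤ 60 := by
      rw [h2 i hi]
      have b1 := hQn i 1
      have b2 := hQn i 2
      have b3 := hn i (hs' hi)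
      have b4 : ‖⁅Q i 1, h i⁆‖ ≤ 2 * (3 * 1) := by
        refine (norm_lie_le _ _).trans ?_
        norm_num at b1
        gcongr
      calc _ ≤ 2 * (‖Q i 2‖ * ‖⁅Q i 1, h i⁆‖) := norm_lie_le _ _
        _ ≤ 2 * (5 * (2 * (3 * 1))) := by
          norm_num at b2
          gcongr
        _ = 60 := by norm_num
    calc _ = hsNorm (⁅P, ⁅P, h i⁆⁆ * 1) := by rw [mul_one]
      _ ≤ _ := (hsNorm_mul_le _ _).trans (mul_le_mul_of_nonneg_right hb (hsNorm_nonneg _))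
  rw [hsum]
  -- The `i`-th term commutes with `h l` once `l` is more than 3 away from `i`, and `Q j 2` only
  -- involves indices within 2 of `j`, so a gap of more than 6 suffices. The constant is 46800 = 13
  -- * 60 ^ 2.
  refine (hsNorm_sum_sq_le (w := 6) hK fun i hi j hj hij => ?_).trans (le_of_eq ?_)
  · rw [h2 j hj]
    refine trace_mul_lie_eq_zero (hQc fun l hl _ _ => ?_) _
    have := (h3 i hi l hl (by omega)).symm.star_star
    rwa [Matrix.star_eq_conjTranspose (h l), (hh l hl).eq] at this
  · rw [mul_pow, hsNorm_one_sq]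
    push_cast
    ring

end Commutators

/-! ### Removing the trace of a sum of disjoint terms -/

section NearestNeighbor

variable {n : ℕ} {h : ℕ → QOp n}

lemma IsNearestNeighbor.commute (hh : IsNearestNeighbor h) {i j : ℕ} (hi : i ∈ Finset.Ico 1 n)
    (hj : j ∈ Finset.Ico 1 n) (hij : i + 2 ≤ j ∨ j + 2 ≤ i) : Commute (h i) (h j) :=
  (hh.actsOn i hi).commute (hh.actsOn j hj) (disjoint_qubitPair hij)

/-- Cauchy–Schwarz against the identity bounds the scalar part by `hsNorm M`; the triangle
inequality does the rest. -/
lemma hsNorm_sub_trace_le {ι : Type*} [Fintype ι] [DecidableEq ι] [Nonempty ι]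
    (M : Matrix ι ι ℂ) :
    hsNorm (M - (M.trace / Fintype.card ι) • (1 : Matrix ι ι ℂ)) ≤ 2 * hsNorm M := by
  have hd : (0 : ℝ) < Fintype.card ι := by exact_mod_cast Fintype.card_pos
  have h1 : ‖M.trace‖ ≤ hsNorm (1 : Matrix ι ι ℂ) * hsNorm M := by
    have := norm_inner_le_norm (𝕜 := ℂ) (hsVec (1 : Matrix ι ι ℂ)) (hsVec M)
    rwa [inner_hsVec, Matrix.conjTranspose_one, one_mul] at this
  refine (hsNorm_sub_le _ _).trans ?_
  rw [two_mul, hsNorm_smul, norm_div, Complex.norm_natCast]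
  gcongr
  rw [div_mul_eq_mul_div, div_le_iff₀ hd, ← hsNorm_one_sq]
  calc _ ≤ hsNorm (1 : Matrix ι ι ℂ) * hsNorm M * hsNorm (1 : Matrix ι ι ℂ) :=
        mul_le_mul_of_nonneg_right h1 (hsNorm_nonneg _)
    _ = _ := by ring

/-- Up to a scalar, a sum of terms with pairwise disjoint supports has Hilbert–Schmidt norm of
order the square root of the number of terms. -/
lemma IsNearestNeighbor.exists_hsNorm_sum_sub_sq_le (hh : IsNearestNeighbor h) {s : Finset ℕ}
    (hs : s ⊆ Finset.Ico 1 n) (hs2 : ∀ i ∈ s, ∀ j ∈ s, i ≠ j → i + 2 ≤ j ∨ j + 2 ≤ i) :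
    ∃ c : ℂ, hsNorm (∑ j ∈ s, h j - c • (1 : QOp n)) ^ 2 ≤
      12 * (s.card * Fintype.card (Fin n → Fin 2)) := by
  set d := Fintype.card (Fin n → Fin 2) with hd
  have hd0 : (d : ℂ) ≠ 0 := by exact_mod_cast Fintype.card_ne_zero
  refine ⟨∑ j ∈ s, (h j).trace / d, ?_⟩
  rw [Finset.sum_smul, ← Finset.sum_sub_distrib]
  have hK : ∀ i ∈ s, hsNorm (h i - ((h i).trace / d) • (1 : QOp n)) ≤
      2 * hsNorm (1 : QOp n) := fun i hi => by
    refine (hsNorm_sub_trace_le (h i)).trans ?_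
    gcongr
    simpa using hsNorm_mul_le_of_norm_le_one (hh.norm_le_one i (hs hi)) 1
  -- Centered operators with disjoint supports are orthogonal, because the trace of the product
  -- factors. The constant is 12 = 3 * 2 ^ 2.
  refine (hsNorm_sum_sq_le (w := 1) hK fun i hi j hj hij => ?_).trans (le_of_eq ?_)
  · have ht := (hh.actsOn i (hs hi)).trace_mul (hh.actsOn j (hs hj))
      (disjoint_qubitPair (hs2 i hi j hj (by omega)))
    have h1 := (hh.isHermitian i (hs hi)).eq
    have h2 : star (h i).trace = (h i).trace := by rw [← Matrix.trace_conjTranspose, h1]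
    rw [← hd] at ht
    have h3 : (1 : QOp n).trace = d := by rw [Matrix.trace_one]
    rw [Matrix.conjTranspose_sub, Matrix.conjTranspose_smul, h1, Matrix.conjTranspose_one,
      star_div₀, h2, star_natCast, sub_mul, mul_sub, mul_sub]
    simp only [Matrix.trace_sub, Matrix.trace_smul, Matrix.smul_mul, Matrix.mul_smul, mul_one,
      one_mul, h3, smul_eq_mul]
    field_simp
    linear_combination ht
  · rw [mul_pow, hsNorm_one_sq]
    push_cast
    ring

end NearestNeighbor

/-! ### Isometry invariance of the surface measure -/

section SphereMeasure

variable {E : Type*} [NormedAddCommGroup E] [InnerProductSpace ℝ E]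

/-- The action of a linear isometry on the unit sphere. -/
def LinearIsometryEquiv.onSphere (f : E ≃ₗᵢ[ℝ] E) (x : Metric.sphere (0 : E) 1) :
    Metric.sphere (0 : E) 1 :=
  ⟨f x, by simp⟩

lemma LinearIsometryEquiv.continuous_onSphere (f : E ≃ₗᵢ[ℝ] E) : Continuous f.onSphere :=
  (f.continuous.comp continuous_subtype_val).subtype_mk _

variable [FiniteDimensional ℝ E] [MeasurableSpace E] [BorelSpace E]

open scoped Pointwise in
/-- The surface measure of the unit sphere is invariant under linear isometries. -/
lemma LinearIsometryEquiv.measurePreserving_onSphere (f : E ≃ₗᵢ[ℝ] E) :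
    MeasurePreserving f.onSphere (volume : Measure E).toSphere (volume : Measure E).toSphere := by
  refine ⟨f.continuous_onSphere.measurable, ?_⟩
  ext s hs
  rw [Measure.map_apply f.continuous_onSphere.measurable hs, Measure.toSphere_apply' _ hs,
    Measure.toSphere_apply' _ (f.continuous_onSphere.measurable hs)]
  congr 1
  -- The surface measure of `s` is a multiple of the volume of the cone over `s`, and `f` preserves
  -- volume and maps cones to cones.
  rw [← f.measurePreserving.measure_preimage_emb f.toHomeomorph.measurableEmbedding
    (Set.Ioo (0 : ℝ) 1 • (Subtype.val '' s))]
  congr 1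
  ext x
  simp only [Set.mem_preimage, Set.mem_smul, Set.mem_image]
  constructor
  · rintro ⟨r, hr, _, ⟨y, hy, rfl⟩, rfl⟩
    exact ⟨r, hr, f y, ⟨f.onSphere y, hy, rfl⟩, by simp⟩
  · rintro ⟨r, hr, _, ⟨y, hy, rfl⟩, hx⟩
    refine ⟨r, hr, f.symm y, ⟨f.symm.onSphere y, ?_, rfl⟩, ?_⟩
    · have : f.onSphere (f.symm.onSphere y) = y := Subtype.ext (f.apply_symm_apply y)
      rwa [this]
    · rw [← f.symm_apply_apply x, ← hx]
      simp

end SphereMeasure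

/-! ### The Haar ensemble is maximally mixed -/

section Haar

variable {n : ℕ}

lemma isProbabilityMeasure_haarState : IsProbabilityMeasure (haarState n) := by
  refine ⟨?_⟩
  have h0 : (volume : Measure (QState n)).toSphere Set.univ ≠ 0 := by
    rw [Ne, Measure.measure_univ_eq_zero]
    exact Measure.toSphere_ne_zero _
  rw [haarState, Measure.smul_apply, smul_eq_mul]
  exact ENNReal.inv_mul_cancel h0 (measure_ne_top _ _)

lemma integral_haarState_onSphere (f : QState n ≃ₗᵢ[ℝ] QState n) {g : PureState n → ℂ}
    (hg : Continuous g) : ∫ ψ, g (f.onSphere ψ) ∂haarState n = ∫ ψ, g ψ ∂haarState n := by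
  have h := f.measurePreserving_onSphere.smul_measure
    ((volume : Measure (QState n)).toSphere Set.univ)⁻¹
  have h2 := integral_map (μ := haarState n) (f := g) f.continuous_onSphere.measurable.aemeasurable
    hg.aestronglyMeasurable
  rw [← h2]
  congr 1
  exact h.map_eq

lemma continuous_entry (x : Fin n → Fin 2) : Continuous fun ψ : PureState n => (ψ : QState n) x :=
  (EuclideanSpace.proj (𝕜 := ℂ) x).continuous.comp continuous_subtype_val

lemma integrable_of_continuous {F : Type*} [NormedAddCommGroup F] {μ : Measure (PureState n)}
    [IsFiniteMeasure μ] {g : PureState n → F} (hg : Continuous g) : Integrable g μ :=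
  hg.integrable_of_hasCompactSupport (HasCompactSupport.of_compactSpace g)

/-- The average state of the Haar ensemble is maximally mixed. -/
lemma averageState_haarState :
    averageState (haarState n) = (Fintype.card (Fin n → Fin 2) : ℂ)⁻¹ • (1 : QOp n) := by
  have hcont (x y : Fin n → Fin 2) : Continuous fun ψ : PureState n =>
      (ψ : QState n) x * star ((ψ : QState n) y) :=
    (continuous_entry x).mul (continuous_entry y).star
  have := isProbabilityMeasure_haarState (n := n)
  have hoff (x y : Fin n → Fin 2) (hxy : x ≠ y) : averageState (haarState n) x y = 0 := by
    -- Flipping the sign of the coordinate `x` negates the off-diagonal entry.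
    let f : QState n ≃ₗᵢ[ℝ] QState n := LinearIsometryEquiv.piLpCongrRight 2 fun z =>
      if z = x then LinearIsometryEquiv.neg ℝ else LinearIsometryEquiv.refl ℝ ℂ
    have h := integral_haarState_onSphere f (hcont x y)
    have hfx (ψ : PureState n) : (f.onSphere ψ : QState n) x = - (ψ : QState n) x := by
      simp [LinearIsometryEquiv.onSphere, f]
    have hfy (ψ : PureState n) : (f.onSphere ψ : QState n) y = (ψ : QState n) y := by
      simp [LinearIsometryEquiv.onSphere, f, hxy.symm]
    simp only [hfx, hfy, neg_mul, integral_neg] at h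
    exact self_eq_neg.1 h.symm
  have hdiag (x y : Fin n → Fin 2) :
      averageState (haarState n) x x = averageState (haarState n) y y := by
    let f : QState n ≃ₗᵢ[ℝ] QState n :=
      LinearIsometryEquiv.piLpCongrLeft 2 ℝ ℂ (Equiv.swap x y)
    have h := integral_haarState_onSphere f (hcont x x)
    have hfx (ψ : PureState n) : (f.onSphere ψ : QState n) x = (ψ : QState n) y := by
      simp [LinearIsometryEquiv.onSphere, f, LinearIsometryEquiv.piLpCongrLeft_apply,
        Equiv.piCongrLeft']
    simp only [hfx] at h
    exact h.symm
  have htr : ∑ x, averageState (haarState n) x x = 1 := by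
    simp only [averageState, Matrix.of_apply]
    rw [← integral_finsetSum _ fun x _ => integrable_of_continuous (hcont x x)]
    have h1 (ψ : PureState n) : ∑ x, (ψ : QState n) x * star ((ψ : QState n) x) = 1 := by
      have h2 := EuclideanSpace.norm_sq_eq (ψ : QState n)
      rw [norm_eq_of_mem_sphere ψ, one_pow] at h2
      simp only [← Complex.ofReal_one, h2, Complex.ofReal_sum, ← Complex.mul_conj', Complex.star_def,
        Complex.ofReal_pow]
    rw [integral_congr_ae (Filter.Eventually.of_forall h1)]
    simp
  ext x y
  by_cases hxy : x = y
  · subst hxy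
    rw [Finset.sum_congr rfl fun z _ => hdiag z x, Finset.sum_const, nsmul_eq_mul,
      Finset.card_univ] at htr
    rw [Matrix.smul_apply, Matrix.one_apply_eq, smul_eq_mul, mul_one]
    exact eq_inv_of_mul_eq_one_right htr
  · simp [hoff x y hxy, hxy]

end Haar

/-! ### From the average error to the Hilbert–Schmidt norm -/

section AverageError

variable {n : ℕ} {μ : Measure (PureState n)}

/-- The variance is nonnegative. -/
lemma sq_integral_le_integral_sq {Ω : Type*} [MeasurableSpace Ω] {ν : Measure Ω}
    [IsProbabilityMeasure ν] {f : Ω → ℝ} (hf : Integrable f ν)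
    (hf2 : Integrable (fun x => f x ^ 2) ν) : (∫ x, f x ∂ν) ^ 2 ≤ ∫ x, f x ^ 2 ∂ν := by
  set m := ∫ x, f x ∂ν with hm
  have h : 0 ≤ ∫ x, (f x - m) ^ 2 ∂ν := integral_nonneg fun x => sq_nonneg _
  have e : (fun x => (f x - m) ^ 2) = fun x => f x ^ 2 - 2 * m * f x + m ^ 2 := by
    ext x; ring
  have hi : Integrable (fun x => f x ^ 2 - 2 * m * f x) ν := hf2.sub (hf.const_mul _)
  rw [e, integral_add hi (integrable_const _),
    integral_sub hf2 (hf.const_mul _), integral_const_mul, ← hm] at h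
  simp at h
  nlinarith

/-- The integrand is linear in |ψ⟩⟨ψ|, so only the average state 1/d matters. -/
lemma IsOneDesign.integral_norm_sq (hμ : IsOneDesign μ) (D : QOp n) :
    ∫ ψ, ‖Matrix.toEuclideanCLM (𝕜 := ℂ) D (ψ : QState n)‖ ^ 2 ∂μ =
      hsNorm D ^ 2 / Fintype.card (Fin n → Fin 2) := by
  have := hμ.isProbabilityMeasure
  have hcont (x y : Fin n → Fin 2) : Continuous fun ψ : PureState n =>
      (ψ : QState n) x * star ((ψ : QState n) y) :=
    (continuous_entry x).mul (continuous_entry y).star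
  have havg (x y : Fin n → Fin 2) : ∫ ψ, (ψ : QState n) x * star ((ψ : QState n) y) ∂μ =
      if x = y then (Fintype.card (Fin n → Fin 2) : ℂ)⁻¹ else 0 := by
    have h := congrFun (congrFun (hμ.averageState_eq.trans averageState_haarState) x) y
    rw [averageState, Matrix.of_apply] at h
    rw [h]
    simp [Matrix.one_apply]
  have hexp (ψ : PureState n) :
      ((‖Matrix.toEuclideanCLM (𝕜 := ℂ) D (ψ : QState n)‖ ^ 2 : ℝ) : ℂ) =
      ∑ x, ∑ y, ∑ z, D x y * star (D x z) * ((ψ : QState n) y * star ((ψ : QState n) z)) := by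
    rw [EuclideanSpace.norm_sq_eq, Complex.ofReal_sum]
    refine Finset.sum_congr rfl fun x _ => ?_
    rw [Complex.ofReal_pow, ← Complex.mul_conj', Matrix.ofLp_toEuclideanCLM]
    simp only [Matrix.mulVec, dotProduct, map_sum, map_mul, Finset.sum_mul_sum, Complex.star_def]
    exact Finset.sum_congr rfl fun y _ => Finset.sum_congr rfl fun z _ => by ring
  apply Complex.ofReal_injective
  rw [← integral_complex_ofReal]
  simp only [hexp]
  rw [integral_finsetSum _ fun x _ => integrable_finsetSum _ fun y _ => integrable_finsetSum _
    fun z _ => (integrable_of_continuous (hcont y z)).const_mul _]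
  rw [hsNorm_sq, Complex.ofReal_div, Complex.ofReal_sum, Finset.sum_div]
  refine Finset.sum_congr rfl fun x _ => ?_
  rw [integral_finsetSum _ fun y _ => integrable_finsetSum _
    fun z _ => (integrable_of_continuous (hcont y z)).const_mul _]
  rw [Complex.ofReal_sum, Finset.sum_div]
  refine Finset.sum_congr rfl fun y _ => ?_
  rw [integral_finsetSum _ fun z _ => (integrable_of_continuous (hcont y z)).const_mul _]
  simp only [integral_const_mul, havg, mul_ite, mul_zero, Finset.sum_ite_eq, Finset.mem_univ,
    if_true]
  rw [Complex.ofReal_pow, ← Complex.mul_conj', Complex.ofReal_natCast, div_eq_mul_inv,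
    Complex.star_def]

/-- The average error over a `1`-design is at most the normalized Hilbert–Schmidt distance. -/
lemma IsOneDesign.averageError_sq_le (hμ : IsOneDesign μ) (U U₀ : QOp n) :
    averageError μ U U₀ ^ 2 ≤ hsNorm (U - U₀) ^ 2 / Fintype.card (Fin n → Fin 2) := by
  have := hμ.isProbabilityMeasure
  rw [← hμ.integral_norm_sq]
  have hc : Continuous fun ψ : PureState n =>
      ‖Matrix.toEuclideanCLM (𝕜 := ℂ) (U - U₀) (ψ : QState n)‖ :=
    ((Matrix.toEuclideanCLM (𝕜 := ℂ) (U - U₀)).continuous.comp continuous_subtype_val).norm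
  refine le_trans (le_of_eq ?_) (sq_integral_le_integral_sq (integrable_of_continuous hc)
    (integrable_of_continuous (hc.pow 2)))
  simp only [averageError, map_sub, sub_apply]

end AverageError

/-! ### The product formula error -/

section TrotterError

variable {n : ℕ} {h : ℕ → QOp n}

lemma IsNearestNeighbor.isHermitian_sum (hh : IsNearestNeighbor h) {s : Finset ℕ}
    (hs : s ⊆ Finset.Ico 1 n) : (∑ j ∈ s, h j).IsHermitian := by
  rw [Matrix.IsHermitian, Matrix.conjTranspose_sum]
  exact Finset.sum_congr rfl fun j hj => (hh.isHermitian j (hs hj)).eq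

lemma hamiltonian_eq_oddPart_add_evenPart (h : ℕ → QOp n) :
    hamiltonian h = oddPart h + evenPart h := by
  simp only [hamiltonian, oddPart, evenPart, ← Nat.not_odd_iff_even]
  exact (Finset.sum_filter_add_sum_filter_not _ _ _).symm

lemma smul_mem_skewAdjoint_of_isHermitian {ι : Type*} {M : Matrix ι ι ℂ} (hM : M.IsHermitian)
    {c : ℂ} (hc : star c = -c) : c • M ∈ skewAdjoint (Matrix ι ι ℂ) := by
  rw [skewAdjoint.mem_iff, Matrix.star_eq_conjTranspose, Matrix.conjTranspose_smul, hM.eq, hc,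
    neg_smul]

lemma smul_lie_smul {ι : Type*} [Fintype ι] (c d : ℂ) (M N : Matrix ι ι ℂ) :
    ⁅c • M, d • N⁆ = (c * d) • ⁅M, N⁆ := by
  simp only [Ring.lie_def, smul_mul_assoc, mul_smul_comm, smul_smul, smul_sub, mul_comm d c]

lemma hsNorm_lie_lie_smul {ι : Type*} [Fintype ι] (c d : ℂ) (M N : Matrix ι ι ℂ) :
    hsNorm ⁅c • M, ⁅c • M, d • N⁆⁆ = ‖c‖ ^ 2 * ‖d‖ * hsNorm ⁅M, ⁅M, N⁆⁆ := by
  rw [smul_lie_smul, smul_lie_smul, hsNorm_smul, norm_mul, norm_mul]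
  ring

lemma evolution_eq_exp_smul (H : QOp n) (s : ℝ) :
    evolution H s = NormedSpace.exp (s • ((-Complex.I) • H)) := by
  rw [evolution, ← Complex.coe_smul, smul_smul]
  congr 2
  ring

lemma IsNearestNeighbor.hsNorm_lie_lie_le (hh : IsNearestNeighbor h) {s s' : Finset ℕ}
    (hs : s ⊆ Finset.Ico 1 n) (hs' : s' ⊆ Finset.Ico 1 n) :
    hsNorm ⁅∑ j ∈ s, h j, ⁅∑ j ∈ s, h j, ∑ i ∈ s', h i⁆⁆ ≤
      217 * Real.sqrt (n * Fintype.card (Fin n → Fin 2)) := by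
  refine le_of_abs_le (abs_le_of_sq_le_sq ?_ (by positivity))
  refine (hsNorm_lie_lie_sum_sq_le hs hs' hh.isHermitian hh.norm_le_one
    fun i hi j hj => hh.commute hi hj).trans ?_
  -- Here 217 ^ 2 = 47089 exceeds 46800.
  rw [mul_pow, Real.sq_sqrt (by positivity)]
  have hcard : s'.card ≤ n := (Finset.card_le_card hs').trans (by simp)
  gcongr
  norm_num

lemma IsNearestNeighbor.exists_hsNorm_oddPart_sub_le (hh : IsNearestNeighbor h) :
    ∃ c : ℂ, hsNorm (oddPart h - c • (1 : QOp n)) ≤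
      4 * Real.sqrt (n * Fintype.card (Fin n → Fin 2)) := by
  obtain ⟨c, hc⟩ := hh.exists_hsNorm_sum_sub_sq_le (Finset.filter_subset Odd (Finset.Ico 1 n))
    fun i hi j hj hij => by
      obtain ⟨a, ha⟩ := (Finset.mem_filter.1 hi).2
      obtain ⟨b, hb⟩ := (Finset.mem_filter.1 hj).2
      omega
  refine ⟨c, le_of_abs_le (abs_le_of_sq_le_sq (hc.trans ?_) (by positivity))⟩
  rw [mul_pow, Real.sq_sqrt (by positivity)]
  have hcard : ((Finset.Ico 1 n).filter Odd).card ≤ n :=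
    (Finset.card_le_card (Finset.filter_subset _ _)).trans (by simp)
  gcongr
  norm_num

/-- The first-order product formula error in the Hilbert–Schmidt norm. -/
lemma IsNearestNeighbor.hsNorm_trotter_sub_evolution_le (hh : IsNearestNeighbor h) {r : ℕ}
    (hr : 0 < r) {t : ℝ} (ht : 0 ≤ t) :
    hsNorm (trotter (oddPart h) (evenPart h) t r - evolution (hamiltonian h) t) ≤
      200 * Real.sqrt (n * Fintype.card (Fin n → Fin 2)) * (t / r + t ^ 3 / (r : ℝ) ^ 2) := by
  have hr' : (0 : ℝ) < r := by exact_mod_cast hr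
  set A := oddPart h with hA
  set B := evenPart h with hB
  set W := Real.sqrt (n * Fintype.card (Fin n → Fin 2)) with hW
  have hodd : (Finset.Ico 1 n).filter Odd ⊆ Finset.Ico 1 n := Finset.filter_subset _ _
  have heven : (Finset.Ico 1 n).filter Even ⊆ Finset.Ico 1 n := Finset.filter_subset _ _
  obtain ⟨c, hc⟩ := hh.exists_hsNorm_oddPart_sub_le
  set p : QOp n := (-Complex.I / 2) • A with hp
  set b : QOp n := (-Complex.I) • B with hb
  have hps : p ∈ skewAdjoint (QOp n) :=
    smul_mem_skewAdjoint_of_isHermitian (hh.isHermitian_sum hodd) (by simp [neg_div])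
  have hbs : b ∈ skewAdjoint (QOp n) :=
    smul_mem_skewAdjoint_of_isHermitian (hh.isHermitian_sum heven) (by simp)
  have hpp : p + p = (-Complex.I) • A := by
    rw [hp, ← add_smul]
    congr 1
    ring
  have hU : trotter A B t r =
      (NormedSpace.exp ((t / r) • (p + p)) * NormedSpace.exp ((t / r) • b)) ^ r := by
    rw [trotter, evolution_eq_exp_smul, evolution_eq_exp_smul, hpp]
  have hU₀ : evolution (hamiltonian h) t = NormedSpace.exp ((t / r) • (p + p + b)) ^ r := by
    rw [← Matrix.exp_nsmul, evolution_eq_exp_smul, hpp, hb, ← smul_add,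
      hamiltonian_eq_oddPart_add_evenPart, ← Nat.cast_smul_eq_nsmul ℝ, smul_smul,
      mul_div_cancel₀ _ hr'.ne']
  have h1 : hsNorm ⁅b, ⁅b, p⁆⁆ ≤ 217 / 2 * W := by
    rw [hb, hp, hsNorm_lie_lie_smul]
    have : hsNorm ⁅B, ⁅B, A⁆⁆ ≤ 217 * W := hh.hsNorm_lie_lie_le heven hodd
    norm_num
    linarith
  have h2 : hsNorm ⁅p, ⁅p, b⁆⁆ ≤ 217 / 4 * W := by
    rw [hb, hp, hsNorm_lie_lie_smul]
    have : hsNorm ⁅A, ⁅A, B⁆⁆ ≤ 217 * W := hh.hsNorm_lie_lie_le hodd heven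
    norm_num
    linarith
  have h3 : hsNorm (p - (-Complex.I / 2 * c) • (1 : QOp n)) ≤ 2 * W := by
    rw [hp, mul_smul, ← smul_sub, hsNorm_smul]
    norm_num
    linarith
  rw [hU, hU₀]
  refine (hsNorm_splitting_sub_exp_le hps hbs (by positivity) r
    (c := -Complex.I / 2 * c)).trans ?_
  have hW0 : 0 ≤ W := Real.sqrt_nonneg _
  calc _ ≤ (r : ℝ) * ((217 / 2 * W + 217 / 4 * W) * (t / r) ^ 3) + 2 * (2 * W) * (t / r) := by
        gcongr
    -- With s = t/r one has r s³ = t³/r², and 217/2 + 217/4 = 651/4 is less than 200.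
    _ = 651 / 4 * W * (t ^ 3 / (r : ℝ) ^ 2) + 4 * W * (t / r) := by
        field_simp
        ring
    _ ≤ 200 * W * (t ^ 3 / (r : ℝ) ^ 2) + 200 * W * (t / r) := by
        gcongr <;> norm_num
    _ = _ := by ring

/-- The first-order product formula error, averaged over a `1`-design. -/
lemma IsNearestNeighbor.averageError_trotter_le (hh : IsNearestNeighbor h)
    {μ : Measure (PureState n)} (hμ : IsOneDesign μ) {r : ℕ} (hr : 0 < r) {t : ℝ} (ht : 0 ≤ t) :
    averageError μ (trotter (oddPart h) (evenPart h) t r) (evolution (hamiltonian h) t) ≤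
      200 * (Real.sqrt n * (t / r + t ^ 3 / (r : ℝ) ^ 2)) := by
  refine le_of_abs_le (abs_le_of_sq_le_sq ((hμ.averageError_sq_le _ _).trans ?_) (by positivity))
  have hd : (0 : ℝ) < Fintype.card (Fin n → Fin 2) := by exact_mod_cast Fintype.card_pos
  rw [div_le_iff₀ hd]
  refine (pow_le_pow_left₀ (hsNorm_nonneg _)
    (hh.hsNorm_trotter_sub_evolution_le hr ht) 2).trans (le_of_eq ?_)
  rw [mul_pow, mul_pow, mul_pow, mul_pow, Real.sq_sqrt (by positivity),
    Real.sq_sqrt (by positivity)]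
  ring

end TrotterError

theorem theorem4 :
    (∀ c : ℝ, c < 1 → ∃ C : ℝ, 0 < C ∧
      ∀ (n r : ℕ) (t : ℝ) (h : ℕ → QOp n) (μ : Measure (PureState n)),
        0 < r → 0 ≤ t → IsNearestNeighbor h → IsOneDesign μ →
        ‖oddPart h * evenPart h - evenPart h * oddPart h‖ * t ^ 2 / (2 * r) ≤ c →
        averageError μ (trotter (oddPart h) (evenPart h) t r) (evolution (hamiltonian h) t) ≤
          C * (Real.sqrt n * (t / r + t ^ 3 / (r : ℝ) ^ 2))) ∧
    (∃ c : ℝ, 0 < c ∧ ∃ C : ℝ, 0 < C ∧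
      ∀ (n r : ℕ) (t : ℝ) (h : ℕ → QOp n) (μ : Measure (PureState n)),
        0 < r → 0 ≤ t → IsNearestNeighbor h → IsOneDesign μ →
        n * t ^ 2 / r ≤ c →
        averageError μ (trotter (oddPart h) (evenPart h) t r) (evolution (hamiltonian h) t) ≤
          C * (Real.sqrt n * (t / r + t ^ 3 / (r : ℝ) ^ 2))) := by
  exact ⟨fun _ _ => ⟨200, by norm_num, fun _ _ _ _ _ hr ht hh hμ _ =>
      hh.averageError_trotter_le hμ hr ht⟩,
    1, one_pos, 200, by norm_num, fun _ _ _ _ _ hr ht hh hμ _ =>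
      hh.averageError_trotter_le hμ hr ht⟩
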